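/- **Theorem (divergence degree formula).** Consider the rank $3$ tensor model over $U(1)$ with a complex field $\varphi_{p_1p_2p_3}$, $p_j\in\mathbb Z$, whose propagator joins a $\varphi$ to a $\bar\varphi$ and conserves $p_1,p_2,p_3$ separately, and whose vertices are the three quartic vertices $$\sum\varphi_{p_1p_2p_3}\,\bar\varphi_{p_1'p_2p_3}\,\varphi_{p_1'p_2'p_3'}\,\bar\varphi_{p_1p_2'p_3'}$$ (and its analogues with position $2$ or $3$ in the place of position $1$), the mass vertex $\sum\bar\varphi_{[p]}\varphi_{[p]}$ and the wave-function vertices $\sum\bar\varphi_{[p]}|p_s|\varphi_{[p]}$, $s=1,2,3$. Let $\mathcal G$ be a (finite, amputated) connected Feynman graph of this model with at least one vertex. Let $V_2$ be its number of mass vertices, $V'_{s;2}$ its number of wave-function vertices of type $s$, $L$ its number of (internal) lines and $N_{\rm ext}$ its number of external fields. Each field has three strands $s=1,2,3$; a *face* is a maximal line made of strands, followed through vertices (where two fields share the strand if they carry the same momentum) and along lines; it is *closed* if it meets no external field and *open* otherwise. Let $F_{\rm int}$ be the number of closed faces and put $$\omega_d(\mathcal G)=-L+F_{\rm int}+\sum_{s=1}^3V'_{s;2}.$$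 The *colored extension* $\mathcal G_{\rm color}$ has one vertex for each field of the vertices of $\mathcal G$ (positive for $\varphi$, negative for $\bar\varphi$), a line of color $0$ for each line of $\mathcal G$, and a line of color $s\in\{1,2,3\}$ between two fields of a vertex of $\mathcal G$ that share the strand $s$ in this vertex; external fields carry an external half-line of color $0$. A *jacket* $J$ of $\mathcal G_{\rm color}$ is the ribbon graph with all the vertices and lines of $\mathcal G_{\rm color}$ given by one of the three cycles $(0abc)$ of the four colors, up to reversal: the half-lines are in this cyclic order around positive vertices and in the reverse order around negative ones. The *pinched jacket* $\widetilde J$ is the closed ribbon graph obtained from $J$ by joining the two border strands of each external half-line at its free end (external half-lines are not counted as lines). The *boundary graph* $\partial\mathcal G$ is the closed ribbon graph whose vertices are the external fields and whose lines are the open faces of $\mathcal G$, a face made of strands $s$ being a line of color $s$ between the two external fields at its ends; the cyclic order is $(123)$ around external fields $\varphi$ and the reverse around external fields $\bar\varphi$. The genus $g$ of a closed ribbon graph with $C$ connected components, $V$ vertices, $L$ lines and $F$ faces is defined by $2C-2g=V-L+F$. Let $C_{\partial\mathcal G}$ be the number of connected components of $\partial\mathcal G$ (if $N_{\rm ext}=0$,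 then $\partial\mathcal G$ is empty, $C_{\partial\mathcal G}=0$ and $g_{\partial\mathcal G}=0$). Then $$\omega_d(\mathcal G)=-V_2-\tfrac12\,(N_{\rm ext}-4)-\sum_J g_{\widetilde J}+g_{\partial\mathcal G}-(C_{\partial\mathcal G}-1),$$ where the sum runs over the three jackets $J$ of $\mathcal G_{\rm color}$. -/

import Mathlib

open Equiv

namespace TensorModel

/-! ### Ribbon graphs -/

/-- A ribbon graph, possibly with external half-lines, presented by permutations of its set `D` of
half-lines: `rot` sends a half-line to the next one in the cyclic order around its vertex, and `flip`
sends a half-line to the other half of its line. The fixed points of `flip` are the external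
half-lines (a line never joins a half-line to itself). The vertices are the cycles of `rot`; every
vertex carries at least one half-line. Lines are untwisted ribbons. -/
structure RibbonGraph (D : Type*) where
  rot : Perm D
  flip : Perm D
  flip_flip : ∀ d, flip (flip d) = d

/-- The number of cycles of a permutation, fixed points included. -/
noncomputable def numCycles {α : Type*} (p : Perm α) : ℕ :=
  Nat.card (Quotient (Perm.SameCycle.setoid p))

/-- The number of unordered pairs `{x, p x}` with `p x ≠ x` (for `p` an involution). -/
noncomputable def numPairs {α : Type*} (p : Perm α) : ℕ :=
  Set.ncard {e : Sym2 α | ∃ x, p x ≠ x ∧ e = s(x, p x)}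

namespace RibbonGraph

variable {D : Type*} (R : RibbonGraph D)

noncomputable def numVertices : ℕ := numCycles R.rot

/-- External half-lines are not lines. -/
noncomputable def numLines : ℕ := numPairs R.flip

/-- The number of faces after pinching, that is after the two border strands of each external
half-line have been joined at its free end: a border strand follows a line to its other end (at an
external half-line it turns around the free end, which is `flip d = d`) and continues with the next
half-line around the vertex. If there are no external half-lines, these are the usual faces. -/
noncomputable def numPinchedFaces : ℕ := numCycles (R.rot * R.flip)

noncomputable def numComponents : ℕ :=
  Nat.card (MulAction.orbitRel.Quotient (Subgroup.closure {R.rot, R.flip}) D)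

/-- The genus `g` of the closed ribbon graph obtained by pinching, given by
`2 C - 2 g = V - L + F`, where `C` is the number of connected components. If there are no external
half-lines, it is the genus of the ribbon graph itself. -/
noncomputable def pinchedGenus : ℚ :=
  R.numComponents - ((R.numVertices : ℚ) - R.numLines + R.numPinchedFaces) / 2

end RibbonGraph

/-! ### Colored graphs -/

/-- A bipartite graph with lines colored by `κ` such that each vertex has exactly one half-line
of each color. `link c v` is the other end of the line of color `c` at `v`; if `link c v = v`, then
the half-line of color `c` at `v` is external. -/
structure ColoredGraph (κ V : Type*) where
  positive : V → Bool
  link : κ → Perm V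
  link_link : ∀ c v, link c (link c v) = v
  link_alternates : ∀ c v, link c v ≠ v → positive (link c v) = !positive v

/-- The jacket of a colored graph for the cyclic order of colors `c, π c, π (π c), …`: the ribbon
graph with all vertices and all lines of the graph whose half-lines are in this cyclic order around
the positive vertices and in the opposite order around the negative ones. So its borders
run along strands shared by two cyclically adjacent colors. -/
def ColoredGraph.jacket {κ V : Type*} (G : ColoredGraph κ V) (π : Perm κ) :
    RibbonGraph (V × κ) where
  rot :=
    { toFun := fun d => (d.1, if G.positive d.1 then π d.2 else π⁻¹ d.2)
      invFun := fun d => (d.1, if G.positive d.1 then π⁻¹ d.2 else π d.2)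
      left_inv := by rintro ⟨v, c⟩; by_cases h : G.positive v <;> simp [h]
      right_inv := by rintro ⟨v, c⟩; by_cases h : G.positive v <;> simp [h] }
  flip :=
    { toFun := fun d => (G.link d.2 d.1, d.2)
      invFun := fun d => (G.link d.2 d.1, d.2)
      left_inv := by rintro ⟨v, c⟩; simp [G.link_link]
      right_inv := by rintro ⟨v, c⟩; simp [G.link_link] }
  flip_flip := by rintro ⟨v, c⟩; simp [G.link_link]

/-- The three jackets of a graph with colors `0, 1, 2, 3`: the cycles `(0123)`, `(0132)`, `(0213)`,
one for each cycle on all four colors up to reversal. -/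
def jacketCycles : Finset (Perm (Fin 4)) := {c[0, 1, 2, 3], c[0, 1, 3, 2], c[0, 2, 1, 3]}

theorem jacketCycles_complete (π : Perm (Fin 4)) :
    π.cycleType = {4} ↔ Xor (π ∈ jacketCycles) (π⁻¹ ∈ jacketCycles) := by
  revert π; decide

theorem card_jacketCycles : jacketCycles.card = 3 := by decide

/-! ### Feynman graphs of the rank 3 model -/

/-- The vertices of the model. `quartic t` is the vertex
`∑ φ_{p₁,p₂,p₃} φ̄_{p₁',p₂,p₃} φ_{p₁',p₂',p₃'} φ̄_{p₁,p₂',p₃'}` (for `t` the first position, and its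
analogues for the other two positions), `mass` is `∑ φ̄_{[p]} φ_{[p]}`, and
`wave t` is `∑ φ̄_{[p]} |p_t| φ_{[p]}`. -/
inductive VertexKind
  | quartic (t : Fin 3)
  | mass
  | wave (t : Fin 3)

/-- The number of pairs `φ φ̄` at a vertex. -/
def VertexKind.pairs : VertexKind → ℕ
  | quartic _ => 2
  | mass => 1
  | wave _ => 1

/-- At a vertex, the strand `s` of a field in the pair `i` runs to the opposite field in the pair
`k.cross s i`. The two pairs of `quartic t` are `(φ_{p₁,p₂,p₃}, φ̄_{p₁',p₂,p₃})` and
`(φ_{p₁',p₂',p₃'}, φ̄_{p₁,p₂',p₃'})` for `t` the first position. -/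
def VertexKind.cross : (k : VertexKind) → Fin 3 → Fin k.pairs → Fin k.pairs
  | quartic t, s, i => if s = t then i.rev else i
  | mass, _, i => i
  | wave _, _, i => i

theorem VertexKind.cross_cross (k : VertexKind) (s : Fin 3) (i : Fin k.pairs) :
    k.cross s (k.cross s i) = i := by
  cases k <;> simp only [VertexKind.cross]
  split_ifs <;> simp

/-- An amputated Feynman graph with vertex set `V`. The fields at the vertex `v` are
the pairs `(b, i)`, with `b = true` for `φ` and `b = false` for `φ̄`. `contract` is the Wick
contraction: it sends a field to the other end of its line, and it fixes the external fields. A line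
joins a `φ` to a `φ̄`. -/
structure FeynmanGraph (V : Type*) where
  kind : V → VertexKind
  contract : Perm (Σ v : V, Bool × Fin (kind v).pairs)
  contract_contract : ∀ x, contract (contract x) = x
  contract_alternates : ∀ x, contract x ≠ x → (contract x).2.1 = !x.2.1

namespace FeynmanGraph

variable {V : Type*} (G : FeynmanGraph V)

/-- The fields (legs) of the vertices of the graph. -/
abbrev Field : Type _ := Σ v : V, Bool × Fin (G.kind v).pairs

/-- The field to which the strand `s` of a field runs inside the vertex. -/
def strand (s : Fin 3) : Perm G.Field where
  toFun x := ⟨x.1, !x.2.1, (G.kind x.1).cross s x.2.2⟩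
  invFun x := ⟨x.1, !x.2.1, (G.kind x.1).cross s x.2.2⟩
  left_inv := by rintro ⟨v, b, i⟩; simp [VertexKind.cross_cross]
  right_inv := by rintro ⟨v, b, i⟩; simp [VertexKind.cross_cross]

theorem strand_strand (s : Fin 3) (x : G.Field) : G.strand s (G.strand s x) = x :=
  (G.strand s).left_inv x

/-- The external fields. -/
abbrev External : Type _ := {x : G.Field // G.contract x = x}

/-- Two distinct vertices are adjacent if a line joins them. -/
def graph : SimpleGraph V := SimpleGraph.fromRel fun v w => ∃ x, x.1 = v ∧ (G.contract x).1 = w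

def Connected : Prop := G.graph.Connected

/-- The number of vertices of the kind `k`. -/
noncomputable def numVertices (k : VertexKind) : ℕ := Nat.card {v : V // G.kind v = k}

noncomputable def numLines : ℕ := numPairs G.contract

noncomputable def numExternal : ℕ := Nat.card G.External

/-- The faces that consist of strands `s`: a strand runs alternately through
vertices and along lines. -/
abbrev Face (s : Fin 3) : Type _ :=
  MulAction.orbitRel.Quotient (Subgroup.closure {G.contract, G.strand s}) G.Field

/-- The number of internal (closed) faces, which are those that meet no external field. -/
noncomputable def numInternalFaces : ℕ :=
  Nat.card {f : Σ s : Fin 3, G.Face s //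
    ∀ x : G.Field, (Quotient.mk _ x : G.Face f.1) = f.2 → G.contract x ≠ x}

/-- The divergence degree `- L + F_int + ∑ s, V'_{s;2}`. -/
noncomputable def divergenceDegree : ℤ :=
  - (G.numLines : ℤ) + G.numInternalFaces + ∑ s : Fin 3, (G.numVertices (.wave s) : ℤ)

/-- The colored extension. The bubble that was integrated out at a vertex of the graph has one
colored vertex for each field of that vertex, and a line of color `s + 1` joins two of
them if they share the strand `s`. The lines of color `0` are the lines of the graph. -/
def colorExtension : ColoredGraph (Fin 4) G.Field where
  positive x := x.2.1
  link := Fin.cons (α := fun _ => Perm G.Field) G.contract G.strand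
  link_link c x := by
    refine Fin.cases ?_ (fun s => ?_) c
    · exact G.contract_contract x
    · exact G.strand_strand s x
  link_alternates c x := by
    refine Fin.cases ?_ (fun s => ?_) c
    · exact G.contract_alternates x
    · exact fun _ => rfl

theorem exists_strandEnd [Finite V] (s : Fin 3) (x : G.External) :
    ∃ n : ℕ, G.contract (((G.strand s * G.contract) ^ (n + 1)) x) =
      ((G.strand s * G.contract) ^ (n + 1)) x := by
  refine ⟨orderOf (G.strand s * G.contract) - 1, ?_⟩
  rw [Nat.sub_add_cancel (orderOf_pos _), pow_orderOf_eq_one]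
  exact x.2

open Classical in
/-- The other end of the open strand `s` that starts at the external field `x`: the first external
field among `S x, S C S x, S C S C S x, …`, where `S` passes through a vertex along the strand and
`C` along a line (note that `C x = x`). -/
noncomputable def strandEnd [Finite V] (s : Fin 3) (x : G.External) : G.External :=
  ⟨((G.strand s * G.contract) ^ (Nat.find (G.exists_strandEnd s x) + 1)) x,
    Nat.find_spec (G.exists_strandEnd s x)⟩

theorem contract_pow (s : Fin 3) (n : ℕ) (x : G.Field) :
    ((G.strand s * G.contract) ^ n) (G.contract (((G.strand s * G.contract) ^ n) x)) =
      G.contract x := by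
  induction n generalizing x with
  | zero => simp
  | succ n ih =>
    have h : ((G.strand s * G.contract) ^ (n + 1)) x =
        G.strand s (G.contract (((G.strand s * G.contract) ^ n) x)) := by
      rw [pow_succ', Perm.mul_apply, Perm.mul_apply]
    rw [h, pow_succ, Perm.mul_apply, Perm.mul_apply, G.contract_contract, G.strand_strand]
    exact ih x

theorem strandEnd_strandEnd [Finite V] (s : Fin 3) (x : G.External) :
    G.strandEnd s (G.strandEnd s x) = x := by
  classical
  set p := G.strand s * G.contract with hp
  set m := Nat.find (G.exists_strandEnd s x) with hm
  have hy : ((G.strandEnd s x : G.External) : G.Field) = (p ^ (m + 1)) x := rfl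
  have hyfix := (G.strandEnd s x).2
  have hback : (p ^ (m + 1)) (G.strandEnd s x : G.Field) = x := by
    have := G.contract_pow s (m + 1) x
    rw [← hp, ← hy, hyfix, x.2] at this
    exact this
  have hfind : Nat.find (G.exists_strandEnd s (G.strandEnd s x)) = m := by
    rw [Nat.find_eq_iff]
    refine ⟨?_, fun k hk hfix => ?_⟩
    · rw [← hp, hback]; exact x.2
    · have h1 := G.contract_pow s (k + 1) (G.strandEnd s x)
      rw [hfix, hyfix, ← hp] at h1
      have h2 : (p ^ (k + 1)) (G.strandEnd s x : G.Field) = (p ^ (m - k)) x := by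
        apply (p ^ (k + 1)).injective
        rw [h1, hy, ← Perm.mul_apply, ← pow_add]
        congr 2; omega
      rw [← hp, h2] at hfix
      refine Nat.find_min (G.exists_strandEnd s x) (m := m - k - 1) (by omega) ?_
      rw [← hp, show m - k - 1 + 1 = m - k by omega]
      exact hfix
  apply Subtype.ext
  change (p ^ (Nat.find (G.exists_strandEnd s (G.strandEnd s x)) + 1)) _ = _
  rw [hfind, hback]

theorem strandEnd_alternates [Finite V] (s : Fin 3) (x : G.External) :
    (G.strandEnd s x).1.2.1 = !x.1.2.1 := by
  classical
  have key : ∀ k ≤ Nat.find (G.exists_strandEnd s x),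
      (((G.strand s * G.contract) ^ (k + 1)) x.1).2.1 = !x.1.2.1 := by
    intro k
    induction k with
    | zero =>
      intro _
      rw [zero_add, pow_one, Perm.mul_apply, x.2]
      rfl
    | succ k ih =>
      intro hk
      have h := Nat.find_min (G.exists_strandEnd s x) (m := k) (by omega)
      rw [pow_succ', Perm.mul_apply, Perm.mul_apply]
      change (!(G.contract _).2.1) = _
      rw [G.contract_alternates _ h, ih (by omega)]
      simp
  exact key _ le_rfl

/-- The boundary graph: its vertices are the external fields, and its lines of color `s` are the
open faces that consist of strands `s`. -/
noncomputable def boundary [Finite V] : ColoredGraph (Fin 3) G.External where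
  positive x := x.1.2.1
  link s := Function.Involutive.toPerm (G.strandEnd s) (G.strandEnd_strandEnd s)
  link_link := G.strandEnd_strandEnd
  link_alternates s x _ := G.strandEnd_alternates s x

/-- The boundary graph as a ribbon graph, which is its own unique jacket. -/
noncomputable def boundaryRibbon [Finite V] : RibbonGraph (G.External × Fin 3) :=
  G.boundary.jacket (finRotate 3)

end FeynmanGraph

end TensorModel

/-! The proof counts the faces of the three pinched jackets together. Each unordered pair of the
four colors is adjacent in exactly two of the three cycles. So every closed face with colors $0,s$
is counted twice, and so is every face with two nonzero colors; the latter lie inside the vertices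
of the graph.

Open faces do not survive separately. If $s,t$ are the neighbors of $0$ in the cycle, pinching an
external half-line glues the open face of color $s$ to that of color $t$ at this external field. The
glued faces are the alternating cycles of colors $s,t$ in the boundary graph. As the jacket varies,
$\{s,t\}$ takes each of its three values once, so each boundary face is counted once.

A quartic vertex has $1+1+2=4$ inner faces for its 4 fields, and a two-point vertex has 3 for its 2
fields, one in excess. With $n$ fields in all, $$\sum_J F_{\widetilde J}=2F_{\rm
int}+2\Big(n+V_2+\sum_s V'_{s;2}\Big)+F_{\partial\mathcal G},$$ which is
`sum_numPinchedFaces_jacket`. The rest is Euler's relation for the jackets and the boundary graph.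

The gluing is carried by `card_quotient_glue` and `numPinchedFaces_jacket`;
`externalJoin_colorExtension` identifies its result with the boundary graph, and `sum_faces` counts
the inner faces. -/

namespace TensorModel

/-! ### Orbits of permutations and pairs of an involution -/

section Orbits

variable {α : Type*}

theorem rel_of_mem_closure {S : Set (Perm α)} (r : Setoid α) (h : ∀ p ∈ S, ∀ x, r x (p x))
    {g : Perm α} (hg : g ∈ Subgroup.closure S) (x : α) : r x (g x) := by
  induction hg using Subgroup.closure_induction generalizing x with
  | mem p hp => exact h p hp x
  | one => exact r.refl x
  | mul p q _ _ hp hq => exact r.trans (hq x) (hp (q x))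
  | inv p _ hp =>
    have := hp (p⁻¹ x)
    rw [show p (p⁻¹ x) = x from p.apply_symm_apply x] at this
    exact r.symm this

theorem rel_of_sameCycle {p : Perm α} (r : Setoid α) (h : ∀ x, r x (p x)) {x y : α}
    (hxy : p.SameCycle x y) : r x y := by
  obtain ⟨n, rfl⟩ := hxy
  have hp : p ^ n ∈ Subgroup.closure {p} := Subgroup.mem_closure_singleton.2 ⟨n, rfl⟩
  exact rel_of_mem_closure r (fun q hq x => Set.mem_singleton_iff.1 hq ▸ h x) hp x

/-- The orbits of the group generated by two permutations. -/
abbrev orbits (p q : Perm α) : Setoid α :=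
  MulAction.orbitRel (Subgroup.closure {p, q}) α

theorem orbits_apply_of_mem {p q g : Perm α} (hg : g ∈ Subgroup.closure {p, q}) (x : α) :
    orbits p q x (g x) :=
  (orbits p q).symm ⟨⟨g, hg⟩, rfl⟩

theorem orbits_left (p q : Perm α) (x : α) : orbits p q x (p x) :=
  orbits_apply_of_mem (Subgroup.subset_closure (by simp)) x

theorem orbits_right (p q : Perm α) (x : α) : orbits p q x (q x) :=
  orbits_apply_of_mem (Subgroup.subset_closure (by simp)) x

theorem orbits_le {p q : Perm α} {r : Setoid α} (hp : ∀ x, r x (p x)) (hq : ∀ x, r x (q x)) :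
    orbits p q ≤ r := by
  rintro x y ⟨⟨g, hg⟩, rfl⟩
  refine r.symm (rel_of_mem_closure r ?_ hg y)
  rintro _ (rfl | rfl)
  exacts [hp, hq]

theorem orbits_comm (p q : Perm α) : orbits p q = orbits q p :=
  le_antisymm (orbits_le (orbits_right q p) (orbits_left q p))
    (orbits_le (orbits_right p q) (orbits_left p q))

theorem two_mul_numPairs_add [Finite α] {p : Perm α} (hp : ∀ x, p (p x) = x) :
    2 * numPairs p + Nat.card {x // p x = x} = Nat.card α := by
  classical
  have := Fintype.ofFinite α
  have hset : {e : Sym2 α | ∃ x, p x ≠ x ∧ e = s(x, p x)} =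
      ((Finset.univ.filter fun x => p x ≠ x).image fun x => s(x, p x) : Finset (Sym2 α)) := by
    ext e
    simp [eq_comm]
  have hfib : ∀ e ∈ (Finset.univ.filter fun x => p x ≠ x).image (fun x => s(x, p x)),
      ((Finset.univ.filter fun x => p x ≠ x).filter fun x => s(x, p x) = e).card = 2 := by
    intro e he
    obtain ⟨x, hx, rfl⟩ := Finset.mem_image.1 he
    have hx : p x ≠ x := by simpa using hx
    rw [← Finset.card_pair hx.symm]
    congr 1
    ext y
    simp only [Finset.mem_filter, Finset.mem_univ, true_and, Finset.mem_insert,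
      Finset.mem_singleton, Sym2.eq_iff]
    constructor
    · rintro ⟨_, h | h⟩
      exacts [Or.inl h.1, Or.inr h.1]
    · rintro (rfl | rfl)
      · simp [hx]
      · simp [hp, hx.symm]
  have hcard := Finset.card_eq_sum_card_image (fun x => s(x, p x))
    (Finset.univ.filter fun x => p x ≠ x)
  rw [Finset.sum_congr rfl hfib, Finset.sum_const, smul_eq_mul] at hcard
  rw [numPairs, hset, Set.ncard_coe_finset, mul_comm, ← hcard, Nat.card_eq_fintype_card,
    Nat.card_eq_fintype_card, Fintype.card_subtype, add_comm,
    Finset.card_filter_add_card_filter_not, Finset.card_univ]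

end Orbits

/-! ### Counting the classes of glued quotients -/

section Gluing

variable {ι X : Type*}

/-- The classes of a disjoint union of quotients of `X`, glued along `E ⊆ X` for the indices in `I`:
a class that misses `E` stays alone, and the others are the classes that the glued quotients
generate on `E`. -/
theorem card_quotient_glue [Fintype ι] [Finite X] (T : Setoid (ι × X)) (r : ι → Setoid X)
    (E : Set X) (I : Set ι) (i₀ : ι) (hi₀ : i₀ ∈ I) (R : Setoid E)
    (hr : ∀ i x y, r i x y → T (i, x) (i, y))
    (hE : ∀ i ∈ I, ∀ j ∈ I, ∀ x ∈ E, T (i, x) (j, x))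
    (hT : ∀ T' : Setoid (ι × X), (∀ i x y, r i x y → T' (i, x) (i, y)) →
      (∀ i ∈ I, ∀ j ∈ I, ∀ x ∈ E, T' (i, x) (j, x)) → T ≤ T')
    (hRr : ∀ i ∈ I, ∀ x y : E, r i x y → R x y)
    (hR : ∀ R' : Setoid E, (∀ i ∈ I, ∀ x y : E, r i x y → R' x y) → R ≤ R') :
    Nat.card (Quotient T) =
      ∑ i, Nat.card {f : Quotient (r i) // i ∈ I → ∀ x, Quotient.mk _ x = f → x ∉ E} +
        Nat.card (Quotient R) := by
  classical
  let A := Σ i, {f : Quotient (r i) // i ∈ I → ∀ x, Quotient.mk _ x = f → x ∉ E}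
  -- A complete invariant of `T`: a glued class is recorded by any point of `E` on it, and `hRr`
  -- makes the choice irrelevant; any other class is recorded as itself.
  let F : ι × X → A ⊕ Quotient R := fun u =>
    if h : u.1 ∈ I ∧ ∃ x : E, r u.1 x u.2 then Sum.inr (Quotient.mk _ h.2.choose)
    else Sum.inl ⟨u.1, Quotient.mk _ u.2, fun hi x hx hxE =>
      h ⟨hi, ⟨x, hxE⟩, Quotient.exact hx⟩⟩
  have Finr : ∀ i ∈ I, ∀ (x : E) (y : X), r i x y → F (i, y) = Sum.inr (Quotient.mk _ x) := by
    intro i hi x y hxy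
    have h : i ∈ I ∧ ∃ x : E, r i x y := ⟨hi, x, hxy⟩
    simp only [F, dif_pos h]
    exact congrArg _ (Quotient.sound
      (hRr i hi _ _ ((r i).trans h.2.choose_spec ((r i).symm hxy))))
  have Fcases : ∀ i x, (i ∈ I ∧ ∃ y : E, r i y x) ∨
      ∃ h, F (i, x) = Sum.inl ⟨i, Quotient.mk _ x, h⟩ := by
    intro i x
    by_cases h : i ∈ I ∧ ∃ y : E, r i y x
    · exact Or.inl h
    · right
      exact ⟨_, dif_neg h⟩
  have hF : ∀ u v, T u v → F u = F v := by
    refine fun u v huv => hT (Setoid.ker F) ?_ ?_ huv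
    · intro i x y hxy
      change F (i, x) = F (i, y)
      rcases Fcases i x with ⟨hi, z, hz⟩ | ⟨h, hx⟩
      · rw [Finr i hi z x hz, Finr i hi z y ((r i).trans hz hxy)]
      · rcases Fcases i y with ⟨hi, z, hz⟩ | ⟨h', hy⟩
        · exact absurd z.2 (h hi z (Quotient.sound ((r i).trans hz ((r i).symm hxy))))
        · rw [hx, hy]
          congr 3
          exact Quotient.sound hxy
    · intro i hi j hj x hx
      change F (i, x) = F (j, x)
      rw [Finr i hi ⟨x, hx⟩ x ((r i).refl x), Finr j hj ⟨x, hx⟩ x ((r j).refl x)]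
  -- By `hE`, points of `E` pass freely between the glued copies, so every generating relation of
  -- `R` can be transported to the copy `i₀`.
  have hRT : ∀ x y : E, R x y → T (i₀, x) (i₀, y) := by
    refine fun x y hxy => hR (T.comap fun x : E => (i₀, (x : X))) ?_ hxy
    intro i hi x y h
    exact T.trans (hE _ hi₀ _ hi x x.2) (T.trans (hr i x y h) (hE _ hi _ hi₀ y y.2))
  have hbij : Function.Bijective (Quotient.lift F hF) := by
    constructor
    · intro u v
      refine Quotient.inductionOn₂ u v ?_
      rintro ⟨i, x⟩ ⟨j, y⟩ h
      change F (i, x) = F (j, y) at h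
      apply Quotient.sound
      change T (i, x) (j, y)
      rcases Fcases i x with ⟨hi, z, hz⟩ | ⟨hh, hx⟩ <;>
        rcases Fcases j y with ⟨hj, w, hw⟩ | ⟨hh', hy⟩
      · rw [Finr i hi z x hz, Finr j hj w y hw] at h
        have hzw := hRT z w (Quotient.exact (Sum.inr_injective h))
        exact T.trans (T.symm (hr i _ _ hz)) (T.trans (hE _ hi _ hi₀ z z.2)
          (T.trans hzw (T.trans (hE _ hi₀ _ hj w w.2) (hr j _ _ hw))))
      · rw [Finr i hi z x hz, hy] at h
        cases h
      · rw [hx, Finr j hj w y hw] at h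
        cases h
      · rw [hx, hy] at h
        have h := Sum.inl_injective h
        obtain rfl : i = j := congrArg Sigma.fst h
        have h := congrArg Subtype.val (eq_of_heq (Sigma.mk.inj h).2)
        exact hr i x y (Quotient.exact h)
    · rintro (⟨i, f, hf⟩ | f)
      · induction f using Quotient.inductionOn with | _ x
        refine ⟨Quotient.mk _ (i, x), ?_⟩
        change F (i, x) = _
        rcases Fcases i x with ⟨hi, z, hz⟩ | ⟨h, hx⟩
        · exact absurd z.2 (hf hi z (Quotient.sound hz))
        · exact hx
      · induction f using Quotient.inductionOn with | _ x
        exact ⟨Quotient.mk _ (i₀, (x : X)), Finr i₀ hi₀ x x ((r i₀).refl _)⟩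
  rw [Nat.card_congr (Equiv.ofBijective _ hbij), Nat.card_sum, Nat.card_sigma]

end Gluing

/-! ### Vertices, lines, components and faces of a jacket -/

namespace ColoredGraph

variable {κ V : Type*} (G : ColoredGraph κ V) (π : Perm κ)

/-- Since `π` is transitive on the colors, the half-lines at a colored vertex form a single cycle of
`rot`, run backwards at negative vertices. -/
theorem numVertices_jacket [Nonempty κ] (hπ : ∀ a b, π.SameCycle a b) :
    (G.jacket π).numVertices = Nat.card V := by
  have hfst : ∀ x y, Perm.SameCycle.setoid (G.jacket π).rot x y → x.1 = y.1 := fun x y h =>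
    rel_of_sameCycle (Setoid.ker (Prod.fst : V × κ → V)) (fun _ => rfl) h
  have hsame : ∀ v a b, (G.jacket π).rot.SameCycle (v, a) (v, b) := by
    intro v a b
    let r : Setoid κ := (Perm.SameCycle.setoid (G.jacket π).rot).comap (Prod.mk v)
    refine rel_of_sameCycle r (fun c => ?_) (hπ a b)
    change (G.jacket π).rot.SameCycle (v, c) (v, π c)
    by_cases h : G.positive v
    · refine ⟨1, ?_⟩
      simp [jacket, h]
    · refine Perm.SameCycle.symm ⟨1, ?_⟩
      simp [jacket, h]
  refine Nat.card_congr (Equiv.ofBijective (Quotient.lift Prod.fst hfst) ⟨?_, ?_⟩)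
  · intro u v
    refine Quotient.inductionOn₂ u v ?_
    rintro ⟨x, a⟩ ⟨y, b⟩ h
    obtain rfl : x = y := h
    exact Quotient.sound (hsame x a b)
  · intro v
    exact ⟨Quotient.mk _ (v, Classical.arbitrary κ), rfl⟩

theorem two_mul_numLines_jacket_add [Finite V] [Finite κ] (c₀ : κ)
    (hfix : ∀ c ≠ c₀, ∀ v, G.link c v ≠ v) :
    2 * (G.jacket π).numLines + Nat.card {v // G.link c₀ v = v} = Nat.card V * Nat.card κ := by
  rw [← Nat.card_prod, ← two_mul_numPairs_add (G.jacket π).flip_flip]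
  congr 1
  have hflip : ∀ v c, (G.jacket π).flip (v, c) = (v, c) ↔ G.link c v = v := by
    intro v c
    simp [jacket]
  refine Nat.card_congr
    { toFun := fun v => ⟨(v, c₀), (hflip _ _).2 v.2⟩
      invFun := fun x => ⟨x.1.1, ?_⟩
      left_inv := fun _ => rfl
      right_inv := ?_ }
  · obtain ⟨⟨v, c⟩, h⟩ := x
    rw [hflip] at h
    by_cases hc : c = c₀
    · exact hc ▸ h
    · exact absurd h (hfix c hc v)
  · rintro ⟨⟨v, c⟩, h⟩
    by_cases hc : c = c₀
    · subst hc; rfl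
    · exact absurd ((hflip _ _).1 h) (hfix c hc v)

theorem numComponents_jacket [Nonempty V] [Nonempty κ] (hπ : ∀ a b, π.SameCycle a b)
    (hG : ∀ r : Setoid V, (∀ c v, r v (G.link c v)) → ∀ v w, r v w) :
    (G.jacket π).numComponents = 1 := by
  let r := orbits (G.jacket π).rot (G.jacket π).flip
  have hcol : ∀ v a b, r (v, a) (v, b) := by
    intro v a b
    refine rel_of_sameCycle (r.comap (Prod.mk v)) (fun c => ?_) (hπ a b)
    change r (v, c) (v, π c)
    by_cases h : G.positive v
    · have := orbits_left (G.jacket π).rot (G.jacket π).flip (v, c)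
      simpa [jacket, h] using this
    · have := orbits_left (G.jacket π).rot (G.jacket π).flip (v, π c)
      refine r.symm ?_
      simpa [jacket, h] using this
  have c := Classical.arbitrary κ
  have hall : ∀ v w, r (v, c) (w, c) := by
    refine hG (r.comap fun v => (v, c)) fun a v => ?_
    exact r.trans (hcol v c a)
      (r.trans (orbits_right (G.jacket π).rot (G.jacket π).flip (v, a)) (hcol _ a c))
  rw [RibbonGraph.numComponents, Nat.card_eq_one_iff_unique]
  refine ⟨⟨fun u v => ?_⟩, ⟨Quotient.mk _ (Classical.arbitrary V, c)⟩⟩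
  refine Quotient.inductionOn₂ u v ?_
  rintro ⟨x, a⟩ ⟨y, b⟩
  exact Quotient.sound (r.trans (hcol x a c) (r.trans (hall x y) (hcol y c b)))

/-- The number of faces with the colors `a` and `b` that meet no external half-line of
color `c₀`. -/
noncomputable def numClosedFaces (c₀ a b : κ) : ℕ :=
  Nat.card {f : Quotient (orbits (G.link a) (G.link b)) //
    a = c₀ ∨ b = c₀ → ∀ v, Quotient.mk _ v = f → G.link c₀ v ≠ v}

theorem numClosedFaces_comm (c₀ a b : κ) :
    G.numClosedFaces c₀ a b = G.numClosedFaces c₀ b a := by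
  simp only [numClosedFaces]
  rw [orbits_comm]
  simp only [or_comm]

/-- The equivalence relation that two families of faces through `c₀` generate on the vertices with
an external half-line of color `c₀`. -/
def externalJoin (c₀ a b : κ) : Setoid {v // G.link c₀ v = v} :=
  (orbits (G.link c₀) (G.link a)).comap Subtype.val ⊔
    (orbits (G.link c₀) (G.link b)).comap Subtype.val

/-- Faces by corners: the corner between the colors `e` and `π e` at the vertex `v` is `(e, v)`. -/
def corner : κ × V ≃ V × κ where
  toFun u := (u.2, if G.positive u.2 then π u.1 else u.1)
  invFun d := (if G.positive d.1 then π⁻¹ d.2 else d.2, d.1)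
  left_inv := by rintro ⟨e, v⟩; by_cases h : G.positive v <;> simp [h]
  right_inv := by rintro ⟨v, c⟩; by_cases h : G.positive v <;> simp [h]

theorem jacket_face_apply (v : V) (c : κ) :
    ((G.jacket π).rot * (G.jacket π).flip) (v, c) =
      (G.link c v, if G.positive (G.link c v) then π c else π⁻¹ c) := rfl

/-- Cut into corners, the jacket is one copy of the vertices for each sector `(e, π e)`. Along
lines, a border stays in its sector and traces a two-colored face; only at an external half-line
does it change sector. Thus `card_quotient_glue` applies. -/
theorem numPinchedFaces_jacket [Finite V] [Fintype κ] (c₀ : κ)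
    (hfix : ∀ c ≠ c₀, ∀ v, G.link c v ≠ v) :
    (G.jacket π).numPinchedFaces = ∑ e, G.numClosedFaces c₀ e (π e) +
      Nat.card (Quotient (G.externalJoin c₀ (π c₀) (π⁻¹ c₀))) := by
  have hinv : ∀ c, π (π⁻¹ c) = c := π.apply_symm_apply
  set φ := (G.jacket π).rot * (G.jacket π).flip with hφ
  let T : Setoid (κ × V) := (Perm.SameCycle.setoid φ).comap (G.corner π)
  have hT : ∀ u w, φ (G.corner π u) = G.corner π w → T u w := fun u w h => ⟨1, by simpa using h⟩
  have hcard : (G.jacket π).numPinchedFaces = Nat.card (Quotient T) :=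
    (Nat.card_congr (Quotient.congr (G.corner π) fun _ _ => Iff.rfl)).symm
  -- The sectors on the two sides of the color `c₀`, the only ones affected by pinching.
  let I : Set κ := {e | e = c₀ ∨ π e = c₀}
  have hI : ∀ e ∈ I, e = c₀ ∨ e = π⁻¹ c₀ := by
    rintro e (rfl | rfl)
    · exact Or.inl rfl
    · exact Or.inr (by simp)
  rw [hcard, card_quotient_glue T (fun e => orbits (G.link e) (G.link (π e)))
    {v | G.link c₀ v = v} I c₀ (Or.inl rfl) (G.externalJoin c₀ (π c₀) (π⁻¹ c₀))]
  · rfl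
  · intro e v w hvw
    refine orbits_le (r := T.comap (Prod.mk e)) (fun v => ?_) (fun v => ?_) hvw
    · change T (e, v) (e, G.link e v)
      by_cases hv : G.link e v = v
      · rw [hv]
      have ha := G.link_alternates e v hv
      -- The border leaves a positive corner along `π e` and a negative one along `e`. Here the line
      -- has color `e`, so for positive `v` it is traversed from its negative end.
      by_cases h : G.positive v
      · refine T.symm (hT _ _ ?_)
        rw [h] at ha
        simp [corner, h, ha, hφ, jacket_face_apply, G.link_link]
      · simp only [h] at ha
        refine hT _ _ ?_
        simp [corner, h, ha, hφ, jacket_face_apply]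
    · change T (e, v) (e, G.link (π e) v)
      by_cases hv : G.link (π e) v = v
      · rw [hv]
      have ha := G.link_alternates (π e) v hv
      by_cases h : G.positive v
      · refine hT _ _ ?_
        rw [h] at ha
        simp [corner, h, ha, hφ, jacket_face_apply]
      · simp only [h] at ha
        refine T.symm (hT _ _ ?_)
        simp [corner, h, ha, hφ, jacket_face_apply, G.link_link]
  -- At an external half-line the border turns around the free end and returns to the same vertex on
  -- the other side of `c₀`.
  · have key : ∀ v, G.link c₀ v = v → T (c₀, v) (π⁻¹ c₀, v) := by
      intro v hv
      by_cases h : G.positive v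
      · refine T.symm (hT _ _ ?_)
        simp [corner, h, hφ, jacket_face_apply, hv]
      · refine hT _ _ ?_
        simp [corner, h, hφ, jacket_face_apply, hv]
    intro i hi j hj v hv
    rcases hI i hi with rfl | rfl <;> rcases hI j hj with rfl | rfl
    exacts [T.refl _, key v hv, T.symm (key v hv), T.refl _]
  · intro T' hr hE u w huw
    have := rel_of_sameCycle (T'.comap (G.corner π).symm) ?_ huw
    · simpa [Setoid.comap_rel] using this
    rintro ⟨v, c⟩
    rw [hφ, jacket_face_apply]
    by_cases hv : G.link c v = v
    · obtain rfl : c = c₀ := by_contra fun hc => hfix c hc v hv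
      have h1 : c ∈ I := Or.inl rfl
      have h2 : π⁻¹ c ∈ I := Or.inr (by simp)
      by_cases h : G.positive v
      · simpa [Setoid.comap_rel, corner, hv, h] using hE _ h2 _ h1 v hv
      · simpa [Setoid.comap_rel, corner, hv, h] using hE _ h1 _ h2 v hv
    · have ha := G.link_alternates c v hv
      by_cases h : G.positive v
      · rw [h] at ha
        have := hr (π⁻¹ c) v (G.link c v) (by
          rw [hinv c]
          exact orbits_right _ _ v)
        simpa [Setoid.comap_rel, corner, ha, h] using this
      · simp only [h] at ha
        have := hr c v (G.link c v) (orbits_left _ _ v)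
        simpa [Setoid.comap_rel, corner, ha, h] using this
  · rintro i hi x y h
    rcases hI i hi with rfl | rfl
    · exact (le_sup_left : _ ≤ G.externalJoin i (π i) (π⁻¹ i)) h
    · refine (le_sup_right : _ ≤ G.externalJoin c₀ (π c₀) (π⁻¹ c₀)) ?_
      rw [hinv, orbits_comm] at h
      exact h
  · intro R' hR'
    refine sup_le (fun x y h => hR' c₀ (Or.inl rfl) x y h) fun x y h => ?_
    refine hR' (π⁻¹ c₀) (Or.inr (by simp)) x y ?_
    rw [hinv, orbits_comm]
    exact h

end ColoredGraph

end TensorModel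

namespace TensorModel

/-! ### Faces inside the vertices -/

namespace VertexKind

/-- The number of faces with strands `s` and `t` at a vertex, for `s ≠ t`. -/
def faces : VertexKind → Fin 3 → Fin 3 → ℕ
  | quartic u, s, t => if u = s ∨ u = t then 1 else 2
  | mass, _, _ => 1
  | wave _, _, _ => 1

/-- A numbering of the faces with strands `s` and `t` at a vertex. -/
theorem exists_faces (k : VertexKind) {s t : Fin 3} (hst : s ≠ t) :
    ∃ f : Bool × Fin k.pairs → Fin (k.faces s t), Function.Surjective f ∧
      (∀ x, f (!x.1, k.cross s x.2) = f x) ∧ (∀ x, f (!x.1, k.cross t x.2) = f x) ∧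
      ∀ r : Setoid (Bool × Fin k.pairs), (∀ x, r x (!x.1, k.cross s x.2)) →
        (∀ x, r x (!x.1, k.cross t x.2)) → ∀ x y, f x = f y → r x y := by
  have bool_rel : ∀ (n : ℕ) (r : Setoid (Bool × Fin n)), (∀ x, r x (!x.1, x.2)) →
      ∀ b c i, r (b, i) (c, i) := by
    intro n r h b c i
    by_cases hbc : c = b
    · subst hbc; exact r.refl _
    · obtain rfl : c = !b := by revert hbc; cases b <;> cases c <;> simp
      exact h (b, i)
  have one : ∀ r : Setoid (Bool × Fin 1), (∀ x, r x (!x.1, x.2)) → ∀ x y, r x y := by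
    rintro r h ⟨b, i⟩ ⟨c, j⟩
    obtain rfl := Subsingleton.elim i j
    exact bool_rel 1 r h b c i
  cases k with
  | quartic u =>
    -- The strand `u` exchanges the two pairs and the other strands preserve them: with `u` all four
    -- fields lie on one face, without it each pair is a face.
    by_cases hu : u = s ∨ u = t
    · rw [show (quartic u).faces s t = 1 from if_pos hu]
      refine ⟨fun _ => 0, fun i => ⟨(true, (0 : Fin 2)), Subsingleton.elim _ _⟩, fun _ => rfl,
        fun _ => rfl, fun r hs ht => ?_⟩
      have key : ∀ r : Setoid (Bool × Fin 2), (∀ x, r x (!x.1, x.2)) →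
          (∀ x, r x (!x.1, x.2.rev)) → ∀ x y, r x y := by
        rintro r h h' ⟨b, i⟩ ⟨c, j⟩
        by_cases hij : j = i
        · subst hij; exact bool_rel 2 r h b c j
        · obtain rfl : j = i.rev := by revert hij; revert i j; decide
          exact r.trans (h' (b, i)) (bool_rel 2 r h _ c i.rev)
      rcases hu with rfl | rfl
      · have ht' : ∀ x : Bool × Fin 2, r x (!x.1, x.2) := fun x => by
          simpa [cross, hst.symm] using ht x
        have hs' : ∀ x : Bool × Fin 2, r x (!x.1, x.2.rev) := fun x => by
          have h := hs x
          rw [show (quartic u).cross u x.2 = Fin.rev (n := 2) x.2 from if_pos rfl] at h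
          exact h
        exact fun x y _ => key r ht' hs' x y
      · have ht' : ∀ x : Bool × Fin 2, r x (!x.1, x.2.rev) := fun x => by
          have h := ht x
          rw [show (quartic u).cross u x.2 = Fin.rev (n := 2) x.2 from if_pos rfl] at h
          exact h
        have hs' : ∀ x : Bool × Fin 2, r x (!x.1, x.2) := fun x => by
          simpa [cross, hst] using hs x
        exact fun x y _ => key r hs' ht' x y
    · rw [show (quartic u).faces s t = 2 from if_neg hu]
      obtain ⟨hs, ht⟩ := not_or.1 hu
      have hs' : ∀ i, (quartic u).cross s i = i := fun i => if_neg (Ne.symm hs)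
      have ht' : ∀ i, (quartic u).cross t i = i := fun i => if_neg (Ne.symm ht)
      refine ⟨Prod.snd, fun i => ⟨(true, i), rfl⟩, fun x => hs' x.2, fun x => ht' x.2,
        fun r h _ => ?_⟩
      rintro ⟨b, i⟩ ⟨c, j⟩ hij
      obtain rfl : i = j := hij
      exact bool_rel 2 r (fun x => by have h := h x; rw [hs'] at h; exact h) b c i
  | mass =>
    exact ⟨Prod.snd, fun i => ⟨(true, i), rfl⟩, fun _ => rfl, fun _ => rfl,
      fun r h _ x y _ => one r h x y⟩
  | wave u =>
    exact ⟨Prod.snd, fun i => ⟨(true, i), rfl⟩, fun _ => rfl, fun _ => rfl,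
      fun r h _ x y _ => one r h x y⟩

open Classical in
theorem faces_add_faces_add_faces (k : VertexKind) :
    k.faces 0 1 + k.faces 1 2 + k.faces 0 2 =
      2 * k.pairs + (if k = mass then 1 else 0) + ∑ s : Fin 3, if k = wave s then 1 else 0 := by
  cases k with
  | quartic u => fin_cases u <;> simp [faces, pairs]
  | mass => simp [faces, pairs]
  | wave u => simp [faces, pairs]

theorem pairs_pos (k : VertexKind) : 0 < k.pairs := by cases k <;> simp [pairs]

end VertexKind

namespace FeynmanGraph

variable {V : Type*} (G : FeynmanGraph V)

/-- The permutations `strand` never leave a vertex, so the count is local. -/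
theorem card_quotient_orbits_strand [Fintype V] {s t : Fin 3} (hst : s ≠ t) :
    Nat.card (Quotient (orbits (G.strand s) (G.strand t))) = ∑ v, (G.kind v).faces s t := by
  choose f hsurj hs ht hr using fun v => (G.kind v).exists_faces hst
  let F : G.Field → Σ v, Fin ((G.kind v).faces s t) := fun x => ⟨x.1, f x.1 x.2⟩
  have hF : ∀ x y, orbits (G.strand s) (G.strand t) x y → F x = F y := fun x y h =>
    orbits_le (r := Setoid.ker F) (fun x => congrArg (Sigma.mk x.1) (hs x.1 x.2).symm)
      (fun x => congrArg (Sigma.mk x.1) (ht x.1 x.2).symm) h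
  rw [Nat.card_congr (Equiv.ofBijective (Quotient.lift F hF) ⟨?_, ?_⟩), Nat.card_sigma]
  · simp
  · intro u v
    refine Quotient.inductionOn₂ u v ?_
    rintro ⟨v, x⟩ ⟨w, y⟩ h
    change F ⟨v, x⟩ = F ⟨w, y⟩ at h
    obtain rfl : v = w := congrArg Sigma.fst h
    have h := eq_of_heq (Sigma.mk.inj h).2
    exact Quotient.sound (hr v ((orbits (G.strand s) (G.strand t)).comap fun x => (⟨v, x⟩ : G.Field))
      (fun x => orbits_left (G.strand s) (G.strand t) ⟨v, x⟩)
      (fun x => orbits_right (G.strand s) (G.strand t) ⟨v, x⟩) x y h)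
  · rintro ⟨v, i⟩
    obtain ⟨x, rfl⟩ := hsurj v i
    exact ⟨Quotient.mk _ ⟨v, x⟩, rfl⟩

theorem card_field [Fintype V] : Nat.card G.Field = ∑ v, 2 * (G.kind v).pairs := by
  rw [Nat.card_sigma]
  simp

open Classical in
theorem numVertices_eq_sum [Fintype V] (k : VertexKind) :
    G.numVertices k = ∑ v, if G.kind v = k then 1 else 0 := by
  rw [numVertices, Nat.card_eq_fintype_card, Fintype.card_subtype, Finset.card_filter]

theorem sum_faces [Finite V] :
    Nat.card (Quotient (orbits (G.strand 0) (G.strand 1))) +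
        Nat.card (Quotient (orbits (G.strand 1) (G.strand 2))) +
        Nat.card (Quotient (orbits (G.strand 0) (G.strand 2))) =
      Nat.card G.Field + G.numVertices .mass + ∑ s, G.numVertices (.wave s) := by
  classical
  have := Fintype.ofFinite V
  rw [card_quotient_orbits_strand G (by decide), card_quotient_orbits_strand G (by decide),
    card_quotient_orbits_strand G (by decide), card_field, ← Finset.sum_add_distrib,
    ← Finset.sum_add_distrib]
  simp_rw [VertexKind.faces_add_faces_add_faces, Finset.sum_add_distrib, numVertices_eq_sum]
  rw [Finset.sum_comm]

/-! ### Connectedness -/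

/-- At every vertex some two strands form a single face through all its fields; at `quartic u` one
of them must be `u`. -/
theorem rel_of_fst_eq (r : Setoid G.Field) (hr : ∀ s x, r x (G.strand s x)) {x y : G.Field}
    (h : x.1 = y.1) : r x y := by
  obtain ⟨v, b, i⟩ := x
  obtain ⟨w, c, j⟩ := y
  obtain rfl : v = w := h
  obtain ⟨s, t, hst, hface⟩ : ∃ s t, s ≠ t ∧ (G.kind v).faces s t = 1 := by
    cases G.kind v with
    | quartic u => exact ⟨u, u + 1, by revert u; decide, by simp [VertexKind.faces]⟩
    | mass => exact ⟨0, 1, by decide, rfl⟩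
    | wave u => exact ⟨0, 1, by decide, rfl⟩
  obtain ⟨f, _, _, _, hf⟩ := (G.kind v).exists_faces hst
  have : Subsingleton (Fin ((G.kind v).faces s t)) := by rw [hface]; infer_instance
  exact hf (r.comap fun x => (⟨v, x⟩ : G.Field)) (fun x => hr s ⟨v, x⟩) (fun x => hr t ⟨v, x⟩) (b, i) (c, j)
    (Subsingleton.elim _ _)

theorem Connected.rel {G : FeynmanGraph V} (hG : G.Connected) (r : Setoid G.Field)
    (hc : ∀ x, r x (G.contract x)) (hs : ∀ s x, r x (G.strand s x)) (x y : G.Field) : r x y := by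
  suffices ∀ v w, G.graph.Reachable v w → ∀ x y : G.Field, x.1 = v → y.1 = w → r x y from
    this _ _ (hG.preconnected x.1 y.1) x y rfl rfl
  rintro v w ⟨p⟩
  induction p with
  | nil => exact fun x y hx hy => G.rel_of_fst_eq r hs (hx.trans hy.symm)
  | cons h _ ih =>
    intro x y hx hy
    obtain ⟨_, ⟨z, hz, hz'⟩ | ⟨z, hz, hz'⟩⟩ := SimpleGraph.fromRel_adj _ _ _ |>.1 h
    · exact r.trans (G.rel_of_fst_eq r hs (hx.trans hz.symm)) (r.trans (hc z) (ih _ y hz' hy))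
    · exact r.trans (G.rel_of_fst_eq r hs (hx.trans hz'.symm))
        (r.trans (r.symm (hc z)) (ih _ y hz hy))

theorem nonempty_field [Nonempty V] : Nonempty G.Field :=
  ⟨⟨Classical.arbitrary V, true, 0, (G.kind _).pairs_pos⟩⟩

/-! ### Open strands -/

/-- Contraction reverses the walk `p`: for external `x`, `contract_pow` sends `contract (p ^ n x)`
back to `x` under `p ^ n`. So the cycle of `x` under `p` is the whole face, and by finiteness
forward steps exhaust it. -/
theorem exists_pow_of_orbits [Finite V] (s : Fin 3) (x : G.External) {y : G.Field}
    (h : orbits G.contract (G.strand s) x y) :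
    ∃ n : ℕ, ((G.strand s * G.contract) ^ n) x = y := by
  set p := G.strand s * G.contract with hp
  have hC : ∀ y, p.SameCycle x y → p.SameCycle x (G.contract y) := by
    intro y hy
    obtain ⟨n, -, rfl⟩ := hy.exists_pow_eq'
    have hn := G.contract_pow s n x
    rw [← hp, x.2] at hn
    exact Perm.SameCycle.symm ⟨n, by simpa using hn⟩
  have hS : ∀ y, p.SameCycle x y → p.SameCycle x (G.strand s y) := by
    intro y hy
    have := Perm.sameCycle_apply_right.2 (hC y hy)
    rwa [hp, Perm.mul_apply, G.contract_contract, ← hp] at this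
  have hxy : p.SameCycle x x = p.SameCycle x y := by
    refine orbits_le (r := Setoid.ker fun y => p.SameCycle x y) (fun y => ?_) (fun y => ?_) h
    · exact propext ⟨hC y, fun hy => by simpa [G.contract_contract] using hC _ hy⟩
    · exact propext ⟨hS y, fun hy => by simpa [G.strand_strand] using hS _ hy⟩
  obtain ⟨n, -, hn⟩ := (hxy ▸ Perm.SameCycle.refl p x.1 : p.SameCycle x y).exists_pow_eq'
  exact ⟨n, hn⟩

/-- `strandEnd` stops at the first external field met, so the walk to `y` passes through it and the
remaining walk is shorter. -/
theorem rel_of_pow_eq [Finite V] (s : Fin 3) (r : Setoid G.External)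
    (hr : ∀ x, r x (G.strandEnd s x)) (n : ℕ) (x y : G.External)
    (h : ((G.strand s * G.contract) ^ n) x = y) : r x y := by
  classical
  induction n using Nat.strong_induction_on generalizing x with
  | _ n ih =>
    rcases n with _ | n
    · rw [Subtype.ext (a1 := x) (a2 := y) h]
    · have hle : Nat.find (G.exists_strandEnd s x) ≤ n := by
        refine Nat.find_min' _ ?_
        rw [h]
        exact y.2
      refine r.trans (hr x) (ih (n - Nat.find (G.exists_strandEnd s x)) (by omega) _ ?_)
      rw [← h]
      change ((G.strand s * G.contract) ^ _)
        (((G.strand s * G.contract) ^ (Nat.find (G.exists_strandEnd s x) + 1)) x) = _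
      rw [← Perm.mul_apply, ← pow_add]
      congr 2
      omega

theorem orbits_strandEnd [Finite V] (s : Fin 3) (x : G.External) :
    orbits G.contract (G.strand s) x (G.strandEnd s x) := by
  refine orbits_apply_of_mem (Subgroup.pow_mem _ (Subgroup.mul_mem _ ?_ ?_) _) _
  · exact Subgroup.subset_closure (by simp)
  · exact Subgroup.subset_closure (by simp)

/-- External fields on a common face with strands `s` are connected by `strandEnd s`. Gluing the
faces of two colors therefore produces exactly the two-colored cycles of the boundary graph. -/
theorem externalJoin_colorExtension [Finite V] (s t : Fin 3) :
    G.colorExtension.externalJoin 0 s.succ t.succ =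
      orbits (G.boundary.link s) (G.boundary.link t) := by
  have hle : ∀ (s : Fin 3) (r : Setoid G.External), (∀ x, r x (G.strandEnd s x)) →
      (orbits G.contract (G.strand s)).comap Subtype.val ≤ r := by
    intro s r hr x y h
    obtain ⟨n, hn⟩ := G.exists_pow_of_orbits s x h
    exact G.rel_of_pow_eq s r hr n x y hn
  refine le_antisymm (sup_le (hle s _ (orbits_left _ _)) (hle t _ (orbits_right _ _)))
    (orbits_le (fun x => ?_) (fun x => ?_))
  · exact (le_sup_left : _ ≤ G.colorExtension.externalJoin 0 s.succ t.succ)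
      (G.orbits_strandEnd s x)
  · exact (le_sup_right : _ ≤ G.colorExtension.externalJoin 0 s.succ t.succ)
      (G.orbits_strandEnd t x)

theorem card_externalJoin_colorExtension [Finite V] (s t : Fin 3) :
    Nat.card (Quotient (G.colorExtension.externalJoin 0 s.succ t.succ)) =
      Nat.card (Quotient (orbits (G.boundary.link s) (G.boundary.link t))) := by
  rw [externalJoin_colorExtension]
  rfl

/-! ### Counting faces -/

theorem numInternalFaces_eq_sum [Finite V] :
    G.numInternalFaces = ∑ s : Fin 3, G.colorExtension.numClosedFaces 0 0 s.succ := by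
  let e : {f : Σ s : Fin 3, G.Face s //
      ∀ x : G.Field, (Quotient.mk _ x : G.Face f.1) = f.2 → G.contract x ≠ x} ≃
      Σ s : Fin 3, {f : G.Face s //
        ∀ x : G.Field, (Quotient.mk _ x : G.Face s) = f → G.contract x ≠ x} :=
    { toFun := fun f => ⟨f.1.1, f.1.2, f.2⟩
      invFun := fun f => ⟨⟨f.1, f.2.1⟩, f.2.2⟩
      left_inv := fun _ => rfl
      right_inv := fun _ => rfl }
  rw [numInternalFaces, Nat.card_congr e, Nat.card_sigma]
  refine Finset.sum_congr rfl fun s _ => Nat.card_congr (Equiv.subtypeEquivRight fun f => ?_)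
  exact ⟨fun h _ => h, fun h => h (Or.inl rfl)⟩

theorem numClosedFaces_succ_succ (s t : Fin 3) :
    G.colorExtension.numClosedFaces 0 s.succ t.succ =
      Nat.card (Quotient (orbits (G.strand s) (G.strand t))) := by
  refine Nat.card_congr (Equiv.subtypeUnivEquiv fun f h => ?_)
  simp [Fin.succ_ne_zero] at h

theorem colorExtension_link_ne (c : Fin 4) (hc : c ≠ 0) (x : G.Field) :
    G.colorExtension.link c x ≠ x := by
  obtain ⟨s, rfl⟩ := Fin.exists_succ_eq.2 hc
  intro h
  have := congrArg (fun y : G.Field => y.2.1) h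
  exact Bool.not_ne_self x.2.1 this

theorem boundary_link_ne [Finite V] (s : Fin 3) (x : G.External) : G.boundary.link s x ≠ x := by
  intro h
  have := G.strandEnd_alternates s x
  rw [show G.strandEnd s x = x from h] at this
  exact Bool.not_ne_self x.1.2.1 this.symm

/-- The boundary graph has no external half-lines, so in the general count for jackets the glued
term vanishes and every face is closed. -/
theorem numPinchedFaces_boundaryRibbon [Finite V] :
    G.boundaryRibbon.numPinchedFaces =
      Nat.card (Quotient (orbits (G.boundary.link 0) (G.boundary.link 1))) +
        Nat.card (Quotient (orbits (G.boundary.link 1) (G.boundary.link 2))) +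
        Nat.card (Quotient (orbits (G.boundary.link 0) (G.boundary.link 2))) := by
  have hempty : IsEmpty {x // G.boundary.link 0 x = x} := ⟨fun x => G.boundary_link_ne 0 x x.2⟩
  have hclosed : ∀ a b, G.boundary.numClosedFaces 0 a b =
      Nat.card (Quotient (orbits (G.boundary.link a) (G.boundary.link b))) := fun a b =>
    Nat.card_congr (Equiv.subtypeUnivEquiv fun f _ x _ => G.boundary_link_ne 0 x)
  rw [boundaryRibbon, ColoredGraph.numPinchedFaces_jacket _ _ 0
    fun c _ => G.boundary_link_ne c]
  simp_rw [hclosed, Fin.sum_univ_three]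
  have hzero : Nat.card (Quotient (G.boundary.externalJoin 0 (finRotate 3 0)
      ((finRotate 3)⁻¹ 0))) = 0 := Nat.card_of_isEmpty
  rw [hzero, orbits_comm (G.boundary.link 0) (G.boundary.link 2)]
  rfl

theorem sum_numPinchedFaces_jacket [Finite V] :
    ∑ π ∈ jacketCycles, (G.colorExtension.jacket π).numPinchedFaces =
      2 * G.numInternalFaces +
        2 * (Nat.card G.Field + G.numVertices .mass + ∑ s, G.numVertices (.wave s)) +
        G.boundaryRibbon.numPinchedFaces := by
  have hface := fun π => G.colorExtension.numPinchedFaces_jacket π 0 G.colorExtension_link_ne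
  have h₁ : ∑ e, G.colorExtension.numClosedFaces 0 e ((c[0, 1, 2, 3] : Perm (Fin 4)) e) =
      G.colorExtension.numClosedFaces 0 0 1 + G.colorExtension.numClosedFaces 0 1 2 +
      G.colorExtension.numClosedFaces 0 2 3 + G.colorExtension.numClosedFaces 0 3 0 :=
    Fin.sum_univ_four _
  have h₂ : ∑ e, G.colorExtension.numClosedFaces 0 e ((c[0, 1, 3, 2] : Perm (Fin 4)) e) =
      G.colorExtension.numClosedFaces 0 0 1 + G.colorExtension.numClosedFaces 0 1 3 +
      G.colorExtension.numClosedFaces 0 2 0 + G.colorExtension.numClosedFaces 0 3 2 :=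
    Fin.sum_univ_four _
  have h₃ : ∑ e, G.colorExtension.numClosedFaces 0 e ((c[0, 2, 1, 3] : Perm (Fin 4)) e) =
      G.colorExtension.numClosedFaces 0 0 2 + G.colorExtension.numClosedFaces 0 1 3 +
      G.colorExtension.numClosedFaces 0 2 1 + G.colorExtension.numClosedFaces 0 3 0 :=
    Fin.sum_univ_four _
  have hcomm := G.colorExtension.numClosedFaces_comm 0
  rw [hcomm 3 0] at h₁ h₃
  rw [hcomm 2 0, hcomm 3 2] at h₂
  rw [hcomm 2 1] at h₃
  have j₁ := hface c[0, 1, 2, 3]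
  have j₂ := hface c[0, 1, 3, 2]
  have j₃ := hface c[0, 2, 1, 3]
  -- The neighbors of color 0 in the three cycles are $\{1,3\}$, $\{1,2\}$ and $\{2,3\}$; shifted
  -- down by one, these are the three pairs of boundary colors.
  rw [h₁, show (c[0, 1, 2, 3] : Perm (Fin 4)) 0 = Fin.succ 0 by decide,
    show (c[0, 1, 2, 3] : Perm (Fin 4))⁻¹ 0 = Fin.succ 2 by decide,
    card_externalJoin_colorExtension] at j₁
  rw [h₂, show (c[0, 1, 3, 2] : Perm (Fin 4)) 0 = Fin.succ 0 by decide,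
    show (c[0, 1, 3, 2] : Perm (Fin 4))⁻¹ 0 = Fin.succ 1 by decide,
    card_externalJoin_colorExtension] at j₂
  rw [h₃, show (c[0, 2, 1, 3] : Perm (Fin 4)) 0 = Fin.succ 1 by decide,
    show (c[0, 2, 1, 3] : Perm (Fin 4))⁻¹ 0 = Fin.succ 2 by decide,
    card_externalJoin_colorExtension] at j₃
  have hint : G.numInternalFaces = G.colorExtension.numClosedFaces 0 0 1 +
      G.colorExtension.numClosedFaces 0 0 2 + G.colorExtension.numClosedFaces 0 0 3 :=
    G.numInternalFaces_eq_sum.trans (Fin.sum_univ_three _)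
  have hbub := G.sum_faces
  have b₁ : G.colorExtension.numClosedFaces 0 1 2 = _ := G.numClosedFaces_succ_succ 0 1
  have b₂ : G.colorExtension.numClosedFaces 0 2 3 = _ := G.numClosedFaces_succ_succ 1 2
  have b₃ : G.colorExtension.numClosedFaces 0 1 3 = _ := G.numClosedFaces_succ_succ 0 2
  rw [jacketCycles, Finset.sum_insert (by decide), Finset.sum_insert (by decide),
    Finset.sum_singleton, numPinchedFaces_boundaryRibbon]
  omega

end FeynmanGraph

end TensorModel

/-! ### Euler's relation and the divergence degree -/

theorem mainTheorem3 {V : Type*} [Finite V] (G : TensorModel.FeynmanGraph V)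
    (hG : G.Connected) :
    (G.divergenceDegree : ℚ) =
      - (G.numVertices .mass : ℚ) - ((G.numExternal : ℚ) - 4) / 2
        - ∑ π ∈ TensorModel.jacketCycles, (G.colorExtension.jacket π).pinchedGenus
        + G.boundaryRibbon.pinchedGenus
        - ((G.boundaryRibbon.numComponents : ℚ) - 1) := by
  have : Nonempty V := hG.nonempty
  have : Nonempty G.Field := G.nonempty_field
  have hlines : 2 * G.numLines + G.numExternal = Nat.card G.Field :=
    TensorModel.two_mul_numPairs_add G.contract_contract
  have hfaces := G.sum_numPinchedFaces_jacket
  -- Each jacket is connected with $n$ vertices and $(4n-N_{\rm ext})/2$ lines, so only its number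
  -- of faces depends on the cycle.
  have hgenus : ∀ π ∈ TensorModel.jacketCycles, (G.colorExtension.jacket π).pinchedGenus =
      1 + (Nat.card G.Field : ℚ) / 2 - (G.numExternal : ℚ) / 4 -
        ((G.colorExtension.jacket π).numPinchedFaces : ℚ) / 2 := by
    intro π hπ
    have hcycle : ∀ a b, π.SameCycle a b := by
      have : ∀ π ∈ TensorModel.jacketCycles, ∀ a b : Fin 4,
          ∃ n : Fin 4, (π ^ (n : ℕ)) a = b := by decide
      intro a b
      obtain ⟨n, hn⟩ := this π hπ a b
      exact ⟨n, by simpa using hn⟩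
    have hV := G.colorExtension.numVertices_jacket π hcycle
    have hC := G.colorExtension.numComponents_jacket π hcycle fun r hr =>
      hG.rel r (hr 0) fun s => hr s.succ
    have hL := G.colorExtension.two_mul_numLines_jacket_add π 0 G.colorExtension_link_ne
    rw [Nat.card_eq_fintype_card (α := Fin 4), Fintype.card_fin] at hL
    have hL : 2 * ((G.colorExtension.jacket π).numLines : ℚ) + G.numExternal =
        Nat.card G.Field * 4 := by exact_mod_cast hL
    rw [TensorModel.RibbonGraph.pinchedGenus, hV, hC, Nat.cast_one]
    linarith
  have hbV : G.boundaryRibbon.numVertices = G.numExternal := by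
    refine G.boundary.numVertices_jacket _ ?_
    have : ∀ a b : Fin 3, ∃ n : Fin 3, (finRotate 3 ^ (n : ℕ)) a = b := by decide
    intro a b
    obtain ⟨n, hn⟩ := this a b
    exact ⟨n, by simpa using hn⟩
  have hbL : 2 * G.boundaryRibbon.numLines = G.numExternal * 3 := by
    have hL := G.boundary.two_mul_numLines_jacket_add (finRotate 3) 0
      fun c _ => G.boundary_link_ne c
    have hempty : IsEmpty {x // G.boundary.link 0 x = x} :=
      ⟨fun x => G.boundary_link_ne 0 x x.2⟩
    rw [Nat.card_of_isEmpty, add_zero, Nat.card_eq_fintype_card (α := Fin 3),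
      Fintype.card_fin] at hL
    exact hL
  rw [Finset.sum_congr rfl hgenus, Finset.sum_sub_distrib, Finset.sum_const,
    TensorModel.card_jacketCycles, ← Finset.sum_div, ← Nat.cast_sum, hfaces,
    TensorModel.RibbonGraph.pinchedGenus, hbV, TensorModel.FeynmanGraph.divergenceDegree]
  have hlines : 2 * (G.numLines : ℚ) + G.numExternal = Nat.card G.Field := by
    exact_mod_cast hlines
  have hbL : 2 * (G.boundaryRibbon.numLines : ℚ) = G.numExternal * 3 := by exact_mod_cast hbL
  push_cast
  rw [← hlines]
  simp only [nsmul_eq_mul, Nat.cast_ofNat]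
  linarith
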